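/- Let $\xi_1,\dots,\xi_K$ be arms (experts), let $\mathcal D$ be a probability distribution on a measurable space $\mathcal Z$, let $L(\xi_j,\cdot):\mathcal Z\to[0,1]$ be measurable losses, and set $\mu_j=\mathbb E_{z\sim\mathcal D}[L(\xi_j,z)]$ and $\Delta_j=\mu_j-\min_i\mu_i$. Let $G$ be a fixed directed feedback graph on $[K]$ with all self-loops, and let $N(i)$ be the set of out-neighbours of $i$. The algorithm UCB-NT is run with the graph $G_t=G$ at every round, on i.i.d. data $z_1,z_2,\dots\sim\mathcal D$: at round $t\ge 1$ it plays an arm $$I_t\in\arg\min_{j\in[K]}\bigl(\widehat\mu_{j,t-1}-S_{j,t-1}\bigr),$$ chosen from the past only (ties are broken arbitrarily, possibly at random, independently of the present and future data), where $$Q_{j,t}=\sum_{s=1}^t 1_{j\in N(I_s)},\qquad S_{j,t}=\sqrt{\tfrac{5\log t}{Q_{j,t}}},\qquad \widehat\mu_{j,t}=\frac1{Q_{j,t}}\sum_{s=1}^t L(\xi_j,z_s)1_{j\in N(I_s)},$$ and $\widehat\mu_{j,t}-S_{j,t}=-\infty$ if $Q_{j,t}=0$. Its regret is $R_T=\sup_{i}\mathbb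 E\bigl[\sum_{t=1}^T L(\xi_{I_t},z_t)-\sum_{t=1}^T L(\xi_i,z_t)\bigr]$. For $C\subseteq[K]$ put $\rho(C)=\max_{i\in C}\Delta_i/\min_{i\in C}\Delta_i^2$, where maximum and minimum are over the suboptimal arms of $C$ (those with $\Delta_i>0$), and $\rho(C)=0$ if $C$ contains no suboptimal arm. For $p\in[K]$, an admissible $p$-partitioning of $G$ is a partition of $[K]$ into $p$ non-empty sets such that $i\in N(j)$ and $j\in N(i)$ whenever $i,j$ lie in the same set. Let $\mathscr S_p$ be the set of all sequences $\bigl((\mathcal C_{t,k})_{k\in[p]}\bigr)_{t\in[T]}$ of admissible $p$-partitionings of $G$, and put $\mathtt C_k=\bigcup_{t\in[T]}\mathcal C_{t,k}$. Let $G_U$ be the undirected graph on $[K]$ in which two distinct arms are adjacent if and only if they are joined by edges of $G$ in both directions; a clique covering of $G_U$ is a family of cliques of $G_U$ whose union is $[K]$. Then there is a universal constant $c>0$ such that, for all such data and all $T\ge1$, both minima below are attained and $$R_T\;\le\; c\Bigl(\min_{p,\,\mathscr S_p}\sum_{k\in[p]}\rho(\mathtt C_k)\,\log T+K\Bigr),\qquad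 \min_{p,\,\mathscr S_p}\sum_{k\in[p]}\rho(\mathtt C_k)\,\log T+K\;\le\;\min_{\mathcal C}\sum_{C\in\mathcal C}\rho(C)\,\log T+K,$$ where the last minimum is over all clique coverings $\mathcal C$ of $G_U$. In particular $R_T=O\bigl(\min_{\mathcal C}\sum_{C\in\mathcal C}\rho(C)\log T+K\bigr)$. -/

import Mathlib

open MeasureTheory ProbabilityTheory

noncomputable section

namespace GraphBandit

open Classical in
/-- `Q_{j,t}`: the number of rounds `s ∈ [t]` at which the loss of arm `j` is observed, i.e. at
which `j` is an out-neighbour in `G_s` of the arm `I_s` that is played. -/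
def obsCount {K : ℕ} (G : ℕ → Digraph (Fin K)) (I : ℕ → Fin K) (j : Fin K) (t : ℕ) : ℕ :=
  ((Finset.Icc 1 t).filter fun s => (G s).Adj (I s) j).card

open Classical in
/-- The average of the losses of arm `j` that were observed during the rounds `1, …, t`. -/
def empMean {K : ℕ} {Z : Type*} (L : Fin K → Z → ℝ) (G : ℕ → Digraph (Fin K)) (I : ℕ → Fin K)
    (z : ℕ → Z) (j : Fin K) (t : ℕ) : ℝ :=
  (∑ s ∈ (Finset.Icc 1 t).filter (fun s => (G s).Adj (I s) j), L j (z s)) / (obsCount G I j t : ℝ)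

/-- The slack `S_{j,t} = √(5 log t / Q_{j,t})`. -/
def slack {K : ℕ} (G : ℕ → Digraph (Fin K)) (I : ℕ → Fin K) (j : Fin K) (t : ℕ) : ℝ :=
  Real.sqrt (5 * Real.log t / (obsCount G I j t : ℝ))

open Classical in
/-- The optimistic index `μ̂_{j,t} - S_{j,t}`. The slack of an arm that has not been observed yet
is infinite, so that its index is `-∞`. -/
def ucbIndex {K : ℕ} {Z : Type*} (L : Fin K → Z → ℝ) (G : ℕ → Digraph (Fin K)) (I : ℕ → Fin K)
    (z : ℕ → Z) (j : Fin K) (t : ℕ) : EReal :=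
  if obsCount G I j t = 0 then ⊥ else ((empMean L G I z j t - slack G I j t : ℝ) : EReal)

/-- The processes `z` (data) and `I` (arms played), both indexed by the rounds `t = 1, 2, …`, form
a run of UCB-NT with the feedback graphs `G_t` on i.i.d. data with law `D`. The filtration `ℱ`
carries the past, including any internal randomness that the algorithm uses to break ties. -/
structure IsUCBNTRun {K : ℕ} {Ω Z : Type*} [MeasurableSpace Ω] [MeasurableSpace Z]
    (P : Measure Ω) (D : Measure Z) (L : Fin K → Z → ℝ) (G : ℕ → Digraph (Fin K))
    (ℱ : Filtration ℕ ‹MeasurableSpace Ω›) (z : ℕ → Ω → Z) (I : ℕ → Ω → Fin K) : Prop where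
  /-- `z_t` belongs to the history up to round `t`. -/
  data_measurable : ∀ t : ℕ, 1 ≤ t → Measurable[ℱ t] (z t)
  /-- `z_t` is independent of the history up to round `t - 1`. -/
  data_indep : ∀ t : ℕ, Indep (MeasurableSpace.comap (z (t + 1)) inferInstance) (ℱ t) P
  /-- `z_t` has law `D`. -/
  data_law : ∀ t : ℕ, 1 ≤ t → P.map (z t) = D
  /-- The arm played in round `t` is chosen from the history up to round `t - 1`. -/
  arm_measurable : ∀ t : ℕ, Measurable[ℱ t] (I (t + 1))
  /-- The arm played in round `t` minimizes `μ̂_{j,t-1} - S_{j,t-1}` over `j`. -/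
  arm_argmin : ∀ (t : ℕ) (ω : Ω) (j : Fin K),
    ucbIndex L G (fun s => I s ω) (fun s => z s ω) (I (t + 1) ω) t
      ≤ ucbIndex L G (fun s => I s ω) (fun s => z s ω) j t

/-- The regret `R_T = sup_i E[∑_{t ≤ T} L(ξ_{I_t}, z_t) - ∑_{t ≤ T} L(ξ_i, z_t)]`. -/
def regret {K : ℕ} {Ω Z : Type*} [MeasurableSpace Ω] (P : Measure Ω) (L : Fin K → Z → ℝ)
    (z : ℕ → Ω → Z) (I : ℕ → Ω → Fin K) (T : ℕ) : ℝ :=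
  ⨆ i : Fin K, ∫ ω, (∑ t ∈ Finset.Icc 1 T, L (I t ω) (z t ω) - ∑ t ∈ Finset.Icc 1 T, L i (z t ω)) ∂P

/-- The expected loss `μ_j` of arm `j`. -/
def meanLoss {K : ℕ} {Z : Type*} [MeasurableSpace Z] (D : Measure Z) (L : Fin K → Z → ℝ)
    (j : Fin K) : ℝ :=
  ∫ x, L j x ∂D

/-- The gap `Δ_j = μ_j - min_i μ_i`. -/
def gap {K : ℕ} {Z : Type*} [MeasurableSpace Z] (D : Measure Z) (L : Fin K → Z → ℝ)
    (j : Fin K) : ℝ :=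
  meanLoss D L j - ⨅ i : Fin K, meanLoss D L i

open Classical in
/-- `max Δ / (min Δ)²`, where maximum and minimum are over the suboptimal arms of `C`;
a set without suboptimal arms costs nothing. -/
def clusterCost {K : ℕ} (Δ : Fin K → ℝ) (C : Finset (Fin K)) : ℝ :=
  if h : (C.filter fun j => 0 < Δ j).Nonempty then
    (C.filter fun j => 0 < Δ j).sup' h Δ / ((C.filter fun j => 0 < Δ j).inf' h Δ) ^ 2
  else 0

/-- Admissible `p`-partitionings of `G`: partitions of the vertices into `p` components such that
any two vertices of a component are joined by reciprocal edges. -/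
structure IsAdmissiblePartition {K : ℕ} (G : Digraph (Fin K)) {p : ℕ}
    (C : Fin p → Finset (Fin K)) : Prop where
  nonempty : ∀ k, (C k).Nonempty
  disjoint : ∀ k l, k ≠ l → Disjoint (C k) (C l)
  covers : ∀ i, ∃ k, i ∈ C k
  reciprocal : ∀ k, ∀ i ∈ C k, ∀ j ∈ C k, G.Adj i j ∧ G.Adj j i

/-- The values `∑_{k ∈ [p]} (max_{j ∈ C_k} Δ_j) / (min_{j ∈ C_k} Δ_j)²`, where `p ∈ [K]`,
`((C_{t,k})_{k ∈ [p]})_{t ∈ [T]}` is a sequence of admissible `p`-partitionings of the graphs `G_t`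
and `C_k = ⋃_{t ∈ [T]} C_{t,k}`. -/
def partitionValues {K : ℕ} (Δ : Fin K → ℝ) (G : ℕ → Digraph (Fin K)) (T : ℕ) : Set ℝ :=
  {x | ∃ p : ℕ, 1 ≤ p ∧ p ≤ K ∧ ∃ C : ℕ → Fin p → Finset (Fin K),
    (∀ t ∈ Finset.Icc 1 T, IsAdmissiblePartition (G t) (C t)) ∧
    x = ∑ k : Fin p, clusterCost Δ ((Finset.Icc 1 T).biUnion fun t => C t k)}

/-- Clique coverings: families of cliques that together contain every vertex. -/
def IsCliqueCovering {K : ℕ} (H : SimpleGraph (Fin K)) (𝒞 : Finset (Finset (Fin K))) : Prop :=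
  (∀ C ∈ 𝒞, H.IsClique (C : Set (Fin K))) ∧ ∀ i, ∃ C ∈ 𝒞, i ∈ C

/-- The values `∑_{C ∈ 𝒞} (max_{i ∈ C} Δ_i) / (min_{i ∈ C} Δ_i)²`, where `𝒞` is a clique covering
of the undirected graph `G_U` whose edges are the doubly-directed edges of `G`. -/
def cliqueCoveringValues {K : ℕ} (Δ : Fin K → ℝ) (G : Digraph (Fin K)) : Set ℝ :=
  {x | ∃ 𝒞 : Finset (Finset (Fin K)), IsCliqueCovering G.toSimpleGraphStrict 𝒞 ∧
    x = ∑ C ∈ 𝒞, clusterCost Δ C}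

end GraphBandit

end

/-! An arm is chosen before its data are drawn, so the regret is at most the expected sum of the
gaps of the arms played (`IsUCBNTRun.regret_le`). Two facts control that sum.

Concentration: whether an arm is observed in a round is decided by the past, so its centred observed
losses form an exponential supermartingale even though the number of observations is random.
Markov's inequality for each possible count, and a union bound over counts, show that an observed
arm is misestimated beyond its slack after `t` rounds with probability at most `2 / t ^ 2`. Over all
arms and rounds this costs at most `4 * K`.

Shared observations: away from these events optimism forces `Q * Δ ^ 2 ≤ 20 * log t` for a
suboptimal arm that is played (`obsCount_mul_sq_gap_le`). Playing any arm of a clique observes the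
whole clique, so `Q` is at least the number of earlier plays of the clique. Its suboptimal arms are
therefore played at most `20 * log T / (min Δ) ^ 2 + 1` times in such rounds, each time at cost at
most `max Δ` (`sum_gap_clique_le`). Summing over the at most `K` cells of a partitioning gives the
regret bound.

The comparison of the minima is combinatorial: the cluster cost is monotone, so a covering can be
shrunk to a partitioning, repeated in every round, at no extra cost. -/

namespace GraphBandit

/-! ### Exponential supermartingale for predictably sampled data. -/

/-- Hoeffding's lemma for a `[0,1]`-valued function, normalised. -/
lemma lintegral_exp_centered_le_one {Z : Type*} [MeasurableSpace Z] (D : Measure Z)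
    [IsProbabilityMeasure D] {f : Z → ℝ} (hf : Measurable f)
    (hf01 : ∀ x, f x ∈ Set.Icc (0 : ℝ) 1) (l : ℝ) :
    ∫⁻ x, ENNReal.ofReal (Real.exp (l * (f x - ∫ y, f y ∂D) - l ^ 2 / 8)) ∂D ≤ 1 := by
  have hs := hasSubgaussianMGF_of_mem_Icc (μ := D) hf.aemeasurable (Filter.Eventually.of_forall hf01)
  have hint := hs.integrable_exp_mul l
  have hle := hs.mgf_le l
  have heq : ∀ x, Real.exp (l * (f x - ∫ y, f y ∂D) - l ^ 2 / 8)
      = Real.exp (l * (f x - ∫ y, f y ∂D)) * Real.exp (-(l ^ 2 / 8)) := fun x => by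
    rw [← Real.exp_add]; ring_nf
  simp_rw [heq]
  rw [← ofReal_integral_eq_lintegral_ofReal (hint.mul_const _)
    (Filter.Eventually.of_forall fun x => by positivity), integral_mul_const,
    ENNReal.ofReal_le_one]
  have h2 : ∫ x, Real.exp (l * (f x - ∫ y, f y ∂D)) ∂D ≤ Real.exp (l ^ 2 / 8) := by
    -- For an interval of length 1 the variance proxy is `(1 / 2) ^ 2`, whence `l ^ 2 / 8`.
    refine hle.trans (Real.exp_le_exp.2 (le_of_eq ?_))
    norm_num
    ring
  calc _ ≤ Real.exp (l ^ 2 / 8) * Real.exp (-(l ^ 2 / 8)) := by gcongr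
    _ = 1 := by rw [← Real.exp_add]; simp

open Classical in
/-- The exponential supermartingale of a predictably sampled i.i.d. sequence has mean at most `1`. -/
lemma lintegral_exp_sum_le_one {Ω Z : Type*} {mΩ : MeasurableSpace Ω} [MeasurableSpace Z]
    (P : Measure Ω) [IsProbabilityMeasure P] (D : Measure Z) [IsProbabilityMeasure D]
    {f : Z → ℝ} (hf : Measurable f) (hf01 : ∀ x, f x ∈ Set.Icc (0 : ℝ) 1)
    (ℱ : Filtration ℕ mΩ) (z : ℕ → Ω → Z) (O : ℕ → Set Ω)
    (hz : ∀ t : ℕ, 1 ≤ t → Measurable[ℱ t] (z t))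
    (hind : ∀ t : ℕ, Indep (MeasurableSpace.comap (z (t + 1)) inferInstance) (ℱ t) P)
    (hlaw : ∀ t : ℕ, 1 ≤ t → P.map (z t) = D)
    (hO : ∀ t : ℕ, MeasurableSet[ℱ t] (O (t + 1))) (l : ℝ) (t : ℕ) :
    ∫⁻ ω, ENNReal.ofReal (Real.exp (∑ s ∈ Finset.Icc 1 t,
      if ω ∈ O s then l * (f (z s ω) - ∫ y, f y ∂D) - l ^ 2 / 8 else 0)) ∂P ≤ 1 := by
  set v : Z → ℝ := fun x => l * (f x - ∫ y, f y ∂D) - l ^ 2 / 8 with hv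
  have hvm : Measurable v := by fun_prop
  have hmeas : ∀ t, Measurable[ℱ t] (fun ω => ENNReal.ofReal (Real.exp (∑ s ∈ Finset.Icc 1 t,
      if ω ∈ O s then v (z s ω) else 0))) := by
    intro t
    refine ENNReal.measurable_ofReal.comp (Real.measurable_exp.comp ?_)
    refine Finset.measurable_fun_sum _ fun s hs => ?_
    rw [Finset.mem_Icc] at hs
    refine Measurable.ite ?_ (hvm.comp ((hz s hs.1).mono (ℱ.mono hs.2) le_rfl)) measurable_const
    obtain ⟨r, rfl⟩ : ∃ r, s = r + 1 := ⟨s - 1, by omega⟩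
    exact ℱ.mono (by omega) _ (hO r)
  induction t with
  | zero => simp
  | succ t ih =>
    refine le_trans ?_ ih
    set U : Ω → ENNReal := fun ω => ENNReal.ofReal (Real.exp (∑ s ∈ Finset.Icc 1 t,
      if ω ∈ O s then v (z s ω) else 0)) with hU
    have hUm : Measurable[ℱ t] U := hmeas t
    set V : Ω → ENNReal := fun ω => ENNReal.ofReal (Real.exp (v (z (t + 1) ω))) with hV
    have hVm : Measurable[MeasurableSpace.comap (z (t + 1)) inferInstance] V :=
      (ENNReal.measurable_ofReal.comp (Real.measurable_exp.comp hvm)).comp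
        (comap_measurable (z (t + 1)))
    have hzm : Measurable (z (t + 1)) := (hz (t + 1) (by omega)).mono (ℱ.le _) le_rfl
    have hOm : MeasurableSet (O (t + 1)) := ℱ.le t _ (hO t)
    have hV1 : ∫⁻ ω, V ω ∂P ≤ 1 := by
      have := lintegral_exp_centered_le_one D hf hf01 l
      rw [← hlaw (t + 1) (by omega), lintegral_map (by fun_prop) hzm] at this
      rw [hlaw (t + 1) (by omega)] at this
      exact this
    -- The new factor `V` enters only on `O (t + 1)`, an event of the past. There it is independent
    -- of `U` and has mean at most 1; on the complement nothing changes.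
    have hsplit : ∀ ω, ENNReal.ofReal (Real.exp (∑ s ∈ Finset.Icc 1 (t + 1),
        if ω ∈ O s then v (z s ω) else 0))
        = (O (t + 1)).indicator U ω * V ω + (O (t + 1))ᶜ.indicator U ω := by
      intro ω
      rw [Finset.sum_Icc_succ_top (by omega), Real.exp_add, ENNReal.ofReal_mul (by positivity)]
      by_cases h : ω ∈ O (t + 1) <;> simp [h, hU, hV]
    have hUi : Measurable[ℱ t] ((O (t + 1)).indicator U) := hUm.indicator (hO t)
    calc _ = ∫⁻ ω, ((O (t + 1)).indicator U ω * V ω + (O (t + 1))ᶜ.indicator U ω) ∂P :=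
          lintegral_congr hsplit
      _ = ∫⁻ ω, (O (t + 1)).indicator U ω * V ω ∂P + ∫⁻ ω, (O (t + 1))ᶜ.indicator U ω ∂P :=
          lintegral_add_right _ ((hUm.mono (ℱ.le t) le_rfl).indicator hOm.compl)
      _ = (∫⁻ ω, (O (t + 1)).indicator U ω ∂P) * ∫⁻ ω, V ω ∂P
            + ∫⁻ ω, (O (t + 1))ᶜ.indicator U ω ∂P := by
          rw [lintegral_mul_eq_lintegral_mul_lintegral_of_independent_measurableSpace (ℱ.le t)
            hzm.comap_le (hind t).symm hUi hVm]
      _ ≤ (∫⁻ ω, (O (t + 1)).indicator U ω ∂P) * 1 + ∫⁻ ω, (O (t + 1))ᶜ.indicator U ω ∂P := by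
          gcongr
      _ = ∫⁻ ω, U ω ∂P := by
          rw [mul_one, lintegral_indicator hOm, lintegral_indicator hOm.compl,
            lintegral_add_compl _ hOm]

/-! ### Cluster costs, partitionings and clique coverings. -/

lemma clusterCost_nonneg {K : ℕ} (Δ : Fin K → ℝ) (C : Finset (Fin K)) : 0 ≤ clusterCost Δ C := by
  unfold clusterCost
  split_ifs with h
  · obtain ⟨j, hj⟩ := h
    exact div_nonneg ((Finset.mem_filter.1 hj).2.le.trans (Finset.le_sup' Δ hj)) (sq_nonneg _)
  · exact le_rfl

/-- A larger cluster has a larger maximal and a smaller minimal positive gap. This drives every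
comparison between partitionings and coverings. -/
lemma clusterCost_mono {K : ℕ} (Δ : Fin K → ℝ) {C C' : Finset (Fin K)} (hC : C ⊆ C') :
    clusterCost Δ C ≤ clusterCost Δ C' := by
  classical
  by_cases h : (C.filter fun j => 0 < Δ j).Nonempty
  · have hsub : (C.filter fun j => 0 < Δ j) ⊆ C'.filter fun j => 0 < Δ j :=
      Finset.filter_subset_filter _ hC
    have h' := h.mono hsub
    rw [clusterCost, clusterCost, dif_pos (by convert h), dif_pos (by convert h')]
    have hpos : 0 < (C'.filter fun j => 0 < Δ j).inf' h' Δ := by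
      rw [Finset.lt_inf'_iff]
      exact fun i hi => (Finset.mem_filter.1 hi).2
    have h1 : (C.filter fun j => 0 < Δ j).sup' h Δ ≤ (C'.filter fun j => 0 < Δ j).sup' h' Δ :=
      Finset.sup'_mono Δ hsub h
    have h2 : (C'.filter fun j => 0 < Δ j).inf' h' Δ ≤ (C.filter fun j => 0 < Δ j).inf' h Δ :=
      Finset.inf'_mono Δ hsub h
    have h3 : 0 ≤ (C'.filter fun j => 0 < Δ j).sup' h' Δ := by
      obtain ⟨j, hj⟩ := h'
      exact (Finset.mem_filter.1 hj).2.le.trans (Finset.le_sup' Δ hj)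
    convert div_le_div₀ h3 h1 (by positivity) (pow_le_pow_left₀ hpos.le h2 2)
  · rw [clusterCost, dif_neg (by convert h)]
    exact clusterCost_nonneg _ _

/-- In a cluster the extreme gaps bound the cost of each suboptimal arm. -/
lemma exists_clusterCost_eq {K : ℕ} (Δ : Fin K → ℝ) (C : Finset (Fin K))
    (h : ∃ j ∈ C, 0 < Δ j) :
    ∃ M m : ℝ, 0 < m ∧ clusterCost Δ C = M / m ^ 2 ∧ (∀ j ∈ C, 0 < Δ j → m ≤ Δ j ∧ Δ j ≤ M) ∧
      ∃ j ∈ C, M = Δ j := by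
  classical
  have hne : (C.filter fun j => 0 < Δ j).Nonempty := by
    obtain ⟨j, hj, hj'⟩ := h
    exact ⟨j, Finset.mem_filter.2 ⟨hj, hj'⟩⟩
  refine ⟨(C.filter fun j => 0 < Δ j).sup' hne Δ, (C.filter fun j => 0 < Δ j).inf' hne Δ,
    ?_, ?_, ?_, ?_⟩
  · rw [Finset.lt_inf'_iff]
    exact fun i hi => (Finset.mem_filter.1 hi).2
  · rw [clusterCost, dif_pos (by convert hne)]
  · intro j hj hj'
    have hm : j ∈ C.filter fun j => 0 < Δ j := Finset.mem_filter.2 ⟨hj, hj'⟩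
    exact ⟨Finset.inf'_le Δ hm, Finset.le_sup' Δ hm⟩
  · obtain ⟨j, hj, hj'⟩ := Finset.exists_mem_eq_sup' hne Δ
    exact ⟨j, (Finset.mem_filter.1 hj).1, hj'⟩

/-- There may be infinitely many sequences `C`, but a value depends only on the unions over rounds,
which are finitely many families of subsets of `Fin K`. -/
lemma finite_partitionValues {K : ℕ} (Δ : Fin K → ℝ) (G : ℕ → Digraph (Fin K)) (T : ℕ) :
    (partitionValues Δ G T).Finite := by
  have : (⋃ p ∈ Set.Iic K, Set.range fun U : Fin p → Finset (Fin K) =>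
      ∑ k, clusterCost Δ (U k)).Finite :=
    Set.Finite.biUnion (Set.finite_Iic K) fun p _ => Set.finite_range _
  refine this.subset ?_
  rintro x ⟨p, -, hp, C, -, rfl⟩
  simp only [Set.mem_iUnion]
  exact ⟨p, hp, _, rfl⟩

lemma finite_cliqueCoveringValues {K : ℕ} (Δ : Fin K → ℝ) (G : Digraph (Fin K)) :
    (cliqueCoveringValues Δ G).Finite := by
  refine (Set.finite_range fun 𝒞 : Finset (Finset (Fin K)) => ∑ C ∈ 𝒞, clusterCost Δ C).subset ?_
  rintro x ⟨𝒞, -, rfl⟩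
  exact ⟨𝒞, rfl⟩

lemma cliqueCoveringValues_nonempty {K : ℕ} (Δ : Fin K → ℝ) (G : Digraph (Fin K)) :
    (cliqueCoveringValues Δ G).Nonempty := by
  classical
  refine ⟨_, Finset.univ.image fun i => {i}, ⟨?_, fun i => ⟨{i}, by simp, by simp⟩⟩, rfl⟩
  intro C hC
  obtain ⟨i, -, rfl⟩ := Finset.mem_image.1 hC
  simp

/-- Every clique covering can be refined to an admissible partitioning that costs no more. -/
lemma exists_partitionValue_le {K : ℕ} (hK : 1 ≤ K) (Δ : Fin K → ℝ) (G : Digraph (Fin K))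
    (hG : ∀ i, G.Adj i i) (T : ℕ) {b : ℝ} (hb : b ∈ cliqueCoveringValues Δ G) :
    ∃ a ∈ partitionValues Δ (fun _ => G) T, a ≤ b := by
  classical
  obtain ⟨𝒞, ⟨hcl, hcov⟩, rfl⟩ := hb
  -- Each vertex selects one clique containing it. The cells are the fibres of `g`; indexing them by
  -- the image `R` makes them non-empty and at most `K` in number.
  choose g hg hig using hcov
  set R : Finset (Finset (Fin K)) := Finset.univ.image g with hR
  let e := R.equivFin
  let C : Fin R.card → Finset (Fin K) := fun k => Finset.univ.filter fun i => g i = (e.symm k).1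
  have hsub : ∀ k, C k ⊆ (e.symm k).1 := fun k i hi => by
    rw [← (Finset.mem_filter.1 hi).2]; exact hig i
  have hR𝒞 : R ⊆ 𝒞 := fun x hx => by
    obtain ⟨i, -, rfl⟩ := Finset.mem_image.1 hx
    exact hg i
  refine ⟨_, ⟨R.card, ?_, ?_, fun _ => C, fun _ _ => ⟨?_, ?_, ?_, ?_⟩, rfl⟩, ?_⟩
  · exact Finset.card_pos.2 ⟨g ⟨0, hK⟩, Finset.mem_image_of_mem _ (Finset.mem_univ _)⟩
  · exact Finset.card_image_le.trans (by simp)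
  · intro k
    obtain ⟨i, -, hi⟩ := Finset.mem_image.1 (e.symm k).2
    exact ⟨i, Finset.mem_filter.2 ⟨Finset.mem_univ _, hi⟩⟩
  · intro k l hkl
    rw [Finset.disjoint_left]
    intro i hi hi'
    exact hkl (e.symm.injective (Subtype.ext
      ((Finset.mem_filter.1 hi).2.symm.trans (Finset.mem_filter.1 hi').2)))
  · intro i
    exact ⟨e ⟨g i, Finset.mem_image_of_mem _ (Finset.mem_univ _)⟩, by simp [C]⟩
  · intro k i hi j hj
    by_cases hij : i = j
    · subst hij; exact ⟨hG i, hG i⟩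
    · exact (hcl _ (hR𝒞 (e.symm k).2) (hsub k hi) (hsub k hj) hij).2
  · calc _ ≤ ∑ k : Fin R.card, clusterCost Δ (e.symm k).1 := by
          refine Finset.sum_le_sum fun k _ => clusterCost_mono Δ ?_
          exact Finset.biUnion_subset.2 fun _ _ => hsub k
      _ = ∑ x : R, clusterCost Δ x.1 := Equiv.sum_comp e.symm fun x : R => clusterCost Δ x.1
      _ = ∑ x ∈ R, clusterCost Δ x := Finset.sum_coe_sort R fun x => clusterCost Δ x
      _ ≤ _ := Finset.sum_le_sum_of_subset_of_nonneg hR𝒞 fun _ _ _ => clusterCost_nonneg _ _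

/-- For a constant feedback graph a single partitioning does as well as a sequence. -/
lemma exists_isAdmissiblePartition_le {K : ℕ} {Δ : Fin K → ℝ} {G : Digraph (Fin K)} {T : ℕ}
    (hT : 1 ≤ T) {a : ℝ} (ha : a ∈ partitionValues Δ (fun _ => G) T) :
    ∃ p : ℕ, p ≤ K ∧ ∃ C : Fin p → Finset (Fin K), IsAdmissiblePartition G C ∧
      ∑ k, clusterCost Δ (C k) ≤ a := by
  obtain ⟨p, -, hp, C, hC, rfl⟩ := ha
  -- Any one round would do: its cells lie inside the unions, so they cost no more.
  have h1 : 1 ∈ Finset.Icc 1 T := Finset.mem_Icc.2 ⟨le_rfl, hT⟩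
  refine ⟨p, hp, C 1, hC 1 h1, Finset.sum_le_sum fun k _ => clusterCost_mono Δ ?_⟩
  exact Finset.subset_biUnion_of_mem (fun t => C t k) h1

/-! ### Probability of misestimation, and the expected loss of the played arm. -/

section Run

variable {K : ℕ} {Ω Z : Type*} {mΩ : MeasurableSpace Ω} [MeasurableSpace Z]
  {P : Measure Ω} {D : Measure Z} {L : Fin K → Z → ℝ} {G : ℕ → Digraph (Fin K)}
  {ℱ : Filtration ℕ mΩ} {z : ℕ → Ω → Z} {I : ℕ → Ω → Fin K}

lemma IsUCBNTRun.measurableSet_obs (h : IsUCBNTRun P D L G ℱ z I) (j : Fin K) (t : ℕ) :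
    MeasurableSet[ℱ t] {ω | (G (t + 1)).Adj (I (t + 1) ω) j} :=
  h.arm_measurable t (MeasurableSet.of_discrete (s := {i | (G (t + 1)).Adj i j}))

lemma IsUCBNTRun.measurable_data (h : IsUCBNTRun P D L G ℱ z I) {t : ℕ} (ht : 1 ≤ t) :
    Measurable (z t) :=
  (h.data_measurable t ht).mono (ℱ.le _) le_rfl

lemma IsUCBNTRun.measurable_arm (h : IsUCBNTRun P D L G ℱ z I) {t : ℕ} (ht : 1 ≤ t) :
    Measurable (I t) := by
  obtain ⟨r, rfl⟩ : ∃ r, t = r + 1 := ⟨t - 1, by omega⟩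
  exact (h.arm_measurable r).mono (ℱ.le _) le_rfl

/-- The event that after `t` rounds the mean of an observed arm `j` is misestimated by more than
the slack. -/
def badEvent (D : Measure Z) (L : Fin K → Z → ℝ) (G : ℕ → Digraph (Fin K))
    (z : ℕ → Ω → Z) (I : ℕ → Ω → Fin K) (j : Fin K) (t : ℕ) : Set Ω :=
  {ω | 0 < obsCount G (fun s => I s ω) j t ∧
    slack G (fun s => I s ω) j t <
      |empMean L G (fun s => I s ω) (fun s => z s ω) j t - meanLoss D L j|}

open Classical in
lemma IsUCBNTRun.measurable_sum_obs (h : IsUCBNTRun P D L G ℱ z I) (j : Fin K) (t : ℕ)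
    {f : Z → ℝ} (hf : Measurable f) :
    Measurable fun ω => ∑ s ∈ (Finset.Icc 1 t).filter (fun s => (G s).Adj (I s ω) j), f (z s ω) := by
  simp_rw [Finset.sum_filter]
  refine Finset.measurable_fun_sum _ fun s hs => ?_
  rw [Finset.mem_Icc] at hs
  refine Measurable.ite ?_ (hf.comp (h.measurable_data hs.1)) measurable_const
  obtain ⟨r, rfl⟩ : ∃ r, s = r + 1 := ⟨s - 1, by omega⟩
  exact ℱ.le r _ (h.measurableSet_obs j r)

lemma IsUCBNTRun.measurable_obsCount (h : IsUCBNTRun P D L G ℱ z I) (j : Fin K) (t : ℕ) :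
    Measurable fun ω => (obsCount G (fun s => I s ω) j t : ℝ) := by
  have := h.measurable_sum_obs j t (measurable_const (a := (1 : ℝ)))
  simpa [obsCount] using this

lemma IsUCBNTRun.measurableSet_badEvent (h : IsUCBNTRun P D L G ℱ z I)
    (hL : ∀ j, Measurable (L j)) (j : Fin K) (t : ℕ) :
    MeasurableSet (badEvent D L G z I j t) := by
  have hQ := h.measurable_obsCount j t
  have hS := h.measurable_sum_obs j t (hL j)
  have : badEvent D L G z I j t = {ω | (0 : ℝ) < (obsCount G (fun s => I s ω) j t : ℝ)} ∩
      {ω | slack G (fun s => I s ω) j t <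
        |empMean L G (fun s => I s ω) (fun s => z s ω) j t - meanLoss D L j|} := by
    ext ω; simp [badEvent]
  rw [this]
  refine (measurableSet_lt measurable_const hQ).inter (measurableSet_lt ?_ ?_)
  · unfold slack; fun_prop
  · exact ((hS.div hQ).sub_const _).abs

open Classical in
/-- One-sided deviation of the empirical mean of an arm observed exactly `n` times. -/
lemma IsUCBNTRun.measure_deviation_le [IsProbabilityMeasure P] [IsProbabilityMeasure D]
    (h : IsUCBNTRun P D L G ℱ z I) (hL : ∀ j, Measurable (L j))
    (hL01 : ∀ j x, L j x ∈ Set.Icc (0 : ℝ) 1) (j : Fin K) {t n : ℕ} (ht : 1 ≤ t) (hn : 1 ≤ n)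
    {σ : ℝ} (hσ : σ ^ 2 = 1) :
    P {ω | obsCount G (fun s => I s ω) j t = n ∧ slack G (fun s => I s ω) j t
      ≤ σ * (empMean L G (fun s => I s ω) (fun s => z s ω) j t - meanLoss D L j)}
      ≤ ENNReal.ofReal (((t : ℝ) ^ 10)⁻¹) := by
  have ht0 : (0 : ℝ) < t := by exact_mod_cast ht
  have hn0 : (0 : ℝ) < n := by exact_mod_cast hn
  have hlog : 0 ≤ Real.log t := Real.log_natCast_nonneg t
  -- Once the count is fixed to `n`, the slack is the deterministic number `r`. The tilt `4 * σ * r`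
  -- used below maximises `l * x - l ^ 2 / 8` at `x = σ * r`; the exponent becomes `2 * n * r ^ 2 =
  -- 10 * log t`, hence the power `t ^ 10`.
  set r := Real.sqrt (5 * Real.log t / n) with hr
  have hr0 : 0 ≤ r := Real.sqrt_nonneg _
  have hr2 : n * r ^ 2 = 5 * Real.log t := by
    rw [hr, Real.sq_sqrt (by positivity)]; field_simp
  have hsm := lintegral_exp_sum_le_one P D (hL j) (hL01 j) ℱ z
    (fun s => {ω | (G s).Adj (I s ω) j}) h.data_measurable h.data_indep h.data_law
    (h.measurableSet_obs j) (4 * σ * r) t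
  have hpos : (0 : ℝ) < (t : ℝ) ^ 10 := by positivity
  refine (measure_mono (t := {ω | ENNReal.ofReal ((t : ℝ) ^ 10) ≤
    ENNReal.ofReal (Real.exp (∑ s ∈ Finset.Icc 1 t, if ω ∈ {ω | (G s).Adj (I s ω) j} then
      4 * σ * r * (L j (z s ω) - ∫ y, L j y ∂D) - (4 * σ * r) ^ 2 / 8 else 0))}) ?_).trans ?_
  · rintro ω ⟨hQ, hd⟩
    refine ENNReal.ofReal_le_ofReal ?_
    have hsum : (∑ s ∈ Finset.Icc 1 t, if ω ∈ {ω | (G s).Adj (I s ω) j} then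
        4 * σ * r * (L j (z s ω) - ∫ y, L j y ∂D) - (4 * σ * r) ^ 2 / 8 else 0)
        = 4 * σ * r * (n * (empMean L G (fun s => I s ω) (fun s => z s ω) j t - meanLoss D L j))
          - n * ((4 * σ * r) ^ 2 / 8) := by
      simp only [Set.mem_ofPred_eq]
      rw [← Finset.sum_filter, Finset.sum_sub_distrib, ← Finset.mul_sum, Finset.sum_sub_distrib,
        Finset.sum_const, Finset.sum_const, empMean, hQ]
      have hQ' : (Finset.filter (fun s => (G s).Adj (I s ω) j) (Finset.Icc 1 t)).card = n := hQ
      rw [hQ', nsmul_eq_mul, nsmul_eq_mul, mul_sub (n : ℝ), mul_div_cancel₀ _ hn0.ne']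
      rfl
    rw [hsum, ← Real.exp_log hpos, Real.exp_le_exp, Real.log_pow]
    rw [slack, hQ] at hd
    have hd' : r * (n * r) ≤ r * (n * (σ *
        (empMean L G (fun s => I s ω) (fun s => z s ω) j t - meanLoss D L j))) := by gcongr
    have : (n : ℝ) * ((4 * σ * r) ^ 2 / 8) = 10 * Real.log t := by
      calc _ = 2 * σ ^ 2 * (n * r ^ 2) := by ring
        _ = _ := by rw [hσ, hr2]; ring
    rw [this]
    push_cast
    nlinarith
  · have hm := mul_meas_ge_le_lintegral₀ (μ := P) (f := fun ω => ENNReal.ofReal (Real.exp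
      (∑ s ∈ Finset.Icc 1 t, if ω ∈ {ω | (G s).Adj (I s ω) j} then
      4 * σ * r * (L j (z s ω) - ∫ y, L j y ∂D) - (4 * σ * r) ^ 2 / 8 else 0))) (by
        have := h.measurable_sum_obs j t (f := fun x => 4 * σ * r * (L j x - ∫ y, L j y ∂D)
          - (4 * σ * r) ^ 2 / 8) (by have := hL j; fun_prop)
        simp_rw [Finset.sum_filter] at this
        exact (ENNReal.measurable_ofReal.comp (Real.measurable_exp.comp this)).aemeasurable)
      (ENNReal.ofReal ((t : ℝ) ^ 10))
    rw [ENNReal.ofReal_inv_of_pos hpos, ENNReal.le_inv_iff_mul_le, mul_comm]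
    exact hm.trans hsm

/-- Union bound over the `t` possible counts and both signs, which gives `2 / t ^ 9`; only
summability is needed, so this is relaxed. -/
lemma IsUCBNTRun.measureReal_badEvent_le [IsProbabilityMeasure P] [IsProbabilityMeasure D]
    (h : IsUCBNTRun P D L G ℱ z I) (hL : ∀ j, Measurable (L j))
    (hL01 : ∀ j x, L j x ∈ Set.Icc (0 : ℝ) 1) (j : Fin K) {t : ℕ} (ht : 1 ≤ t) :
    P.real (badEvent D L G z I j t) ≤ 2 / (t : ℝ) ^ 2 := by
  classical
  have ht1 : (1 : ℝ) ≤ t := by exact_mod_cast ht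
  let A : ℝ → ℕ → Set Ω := fun σ n => {ω | obsCount G (fun s => I s ω) j t = n ∧
    slack G (fun s => I s ω) j t
      ≤ σ * (empMean L G (fun s => I s ω) (fun s => z s ω) j t - meanLoss D L j)}
  have hA : ∀ σ : ℝ, σ ^ 2 = 1 → ∀ n ∈ Finset.Icc 1 t, P.real (A σ n) ≤ ((t : ℝ) ^ 10)⁻¹ :=
    fun σ hσ n hn => ENNReal.toReal_le_of_le_ofReal (by positivity)
      (h.measure_deviation_le hL hL01 j ht (Finset.mem_Icc.1 hn).1 hσ)
  have hsub : badEvent D L G z I j t ⊆ ⋃ n ∈ Finset.Icc 1 t, (A 1 n ∪ A (-1) n) := by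
    rintro ω ⟨hQ, hd⟩
    have hQt : obsCount G (fun s => I s ω) j t ≤ t :=
      (Finset.card_filter_le _ _).trans (by simp)
    simp only [Set.mem_iUnion]
    refine ⟨_, Finset.mem_Icc.2 ⟨hQ, hQt⟩, ?_⟩
    rcases lt_abs.1 hd with hd | hd
    · exact Or.inl ⟨rfl, by linarith⟩
    · exact Or.inr ⟨rfl, by linarith⟩
  calc _ ≤ P.real (⋃ n ∈ Finset.Icc 1 t, (A 1 n ∪ A (-1) n)) := measureReal_mono hsub (measure_ne_top _ _)
    _ ≤ ∑ n ∈ Finset.Icc 1 t, P.real (A 1 n ∪ A (-1) n) := measureReal_biUnion_finset_le _ _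
    _ ≤ ∑ n ∈ Finset.Icc 1 t, (((t : ℝ) ^ 10)⁻¹ + ((t : ℝ) ^ 10)⁻¹) :=
        Finset.sum_le_sum fun n hn => (measureReal_union_le _ _).trans
          (add_le_add (hA 1 (by norm_num) n hn) (hA (-1) (by norm_num) n hn))
    _ = 2 / (t : ℝ) ^ 9 := by
        rw [Finset.sum_const, Nat.card_Icc, nsmul_eq_mul, Nat.add_sub_cancel]
        field_simp
        norm_num
    _ ≤ 2 / (t : ℝ) ^ 2 := by
        gcongr
        norm_num

/-- The expected loss of the arm that is played is the expectation of its mean loss. -/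
lemma IsUCBNTRun.integral_loss_arm [IsProbabilityMeasure P] [IsProbabilityMeasure D]
    (h : IsUCBNTRun P D L G ℱ z I) (hL : ∀ j, Measurable (L j))
    (hL01 : ∀ j x, L j x ∈ Set.Icc (0 : ℝ) 1) (t : ℕ) :
    ∫ ω, L (I (t + 1) ω) (z (t + 1) ω) ∂P = ∫ ω, meanLoss D L (I (t + 1) ω) ∂P := by
  classical
  have hz := h.measurable_data (t := t + 1) (by omega)
  have hI := h.measurable_arm (t := t + 1) (by omega)
  let φ : Fin K → Ω → ℝ := fun j ω => if I (t + 1) ω = j then 1 else 0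
  have hφm : ∀ j, Measurable[ℱ t] (φ j) := fun j =>
    Measurable.ite (h.arm_measurable t (MeasurableSet.singleton j)) measurable_const measurable_const
  have hLz : ∀ j, ∫ ω, L j (z (t + 1) ω) ∂P = meanLoss D L j := fun j => by
    rw [meanLoss, ← h.data_law (t + 1) (by omega),
      integral_map hz.aemeasurable (hL j).aestronglyMeasurable]
  have hb : ∀ (a : Fin K → Ω → ℝ) (M : ℝ), (∀ j, Measurable (a j)) → (∀ j ω, |a j ω| ≤ M) →
      ∀ j, Integrable (fun ω => φ j ω * a j ω) P := by
    intro a M ha hM j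
    refine Integrable.of_bound (C := M)
      (((hφm j).mono (ℱ.le t) le_rfl).mul (ha j)).aestronglyMeasurable
      (Filter.Eventually.of_forall fun ω => ?_)
    simp only [φ, Real.norm_eq_abs]
    split_ifs
    · simpa using hM j ω
    · simpa using (abs_nonneg _).trans (hM j ω)
  -- The choice of arm is known after round `t`, hence independent of `z (t + 1)`.
  have hind : ∀ j, IndepFun (φ j) (fun ω => L j (z (t + 1) ω)) P := fun j =>
    indep_of_indep_of_le_left (indep_of_indep_of_le_right (h.data_indep t).symm
      (Measurable.comap_le ((hL j).comp (comap_measurable _)))) (hφm j).comap_le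
  have hsum : ∀ a : Fin K → Ω → ℝ, (fun ω => a (I (t + 1) ω) ω) = fun ω => ∑ j, φ j ω * a j ω := by
    intro a; ext ω; simp [φ]
  have habs : ∀ j x, |L j x| ≤ 1 := fun j x => abs_le.2 ⟨by linarith [(hL01 j x).1], (hL01 j x).2⟩
  rw [hsum fun j ω => L j (z (t + 1) ω), hsum fun j _ => meanLoss D L j,
    integral_finsetSum _ fun j _ => hb (fun j ω => L j (z (t + 1) ω)) 1
      (fun j => (hL j).comp hz) (fun j ω => habs j _) j,
    integral_finsetSum _ fun j _ => hb (fun j _ => meanLoss D L j) (∑ i, |meanLoss D L i|)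
      (fun j => measurable_const) (fun j ω => Finset.single_le_sum
        (f := fun i => |meanLoss D L i|) (fun i _ => abs_nonneg _) (Finset.mem_univ j)) j]
  refine Finset.sum_congr rfl fun j _ => ?_
  rw [(hind j).integral_fun_mul_eq_mul_integral
    ((hφm j).mono (ℱ.le t) le_rfl).aestronglyMeasurable ((hL j).comp hz).aestronglyMeasurable,
    hLz, integral_mul_const]

end Run

/-! ### Pathwise bounds on the pseudo-regret. -/

lemma gap_mem_Icc {K : ℕ} {Z : Type*} [MeasurableSpace Z] {D : Measure Z} [IsProbabilityMeasure D]
    {L : Fin K → Z → ℝ} (hL : ∀ j, Measurable (L j)) (hL01 : ∀ j x, L j x ∈ Set.Icc (0 : ℝ) 1)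
    (j : Fin K) : gap D L j ∈ Set.Icc (0 : ℝ) 1 := by
  have hint : ∀ i, Integrable (L i) D := fun i =>
    Integrable.of_mem_Icc 0 1 (hL i).aemeasurable (Filter.Eventually.of_forall (hL01 i))
  have h0 : ∀ i, 0 ≤ meanLoss D L i := fun i => integral_nonneg fun x => (hL01 i x).1
  have h1 : meanLoss D L j ≤ 1 := by
    have := integral_mono (hint j) (integrable_const 1) fun x => (hL01 j x).2
    simpa [meanLoss] using this
  have : Nonempty (Fin K) := ⟨j⟩
  have h2 : 0 ≤ ⨅ i, meanLoss D L i := le_ciInf h0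
  have h3 : ⨅ i, meanLoss D L i ≤ meanLoss D L j := ciInf_le (Set.finite_range _).bddBelow j
  constructor <;> unfold gap <;> linarith

/-- If all observed arms are estimated up to their slack, then a suboptimal arm is only played
while it has been observed rarely. -/
lemma obsCount_mul_sq_gap_le {K : ℕ} {Z : Type*} [MeasurableSpace Z] {D : Measure Z}
    {L : Fin K → Z → ℝ} {G : ℕ → Digraph (Fin K)} {I : ℕ → Fin K} {z : ℕ → Z} {i : Fin K} {t : ℕ}
    (hmin : ∀ j, ucbIndex L G I z i t ≤ ucbIndex L G I z j t)
    (hgood : ∀ j, 0 < obsCount G I j t → |empMean L G I z j t - meanLoss D L j| ≤ slack G I j t)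
    (hi : 0 < gap D L i) :
    (obsCount G I i t : ℝ) * gap D L i ^ 2 ≤ 20 * Real.log t := by
  have hlog : 0 ≤ Real.log t := Real.log_natCast_nonneg t
  have : Nonempty (Fin K) := ⟨i⟩
  obtain ⟨o, ho⟩ := exists_eq_ciInf_of_finite (f := meanLoss D L)
  rcases Nat.eq_zero_or_pos (obsCount G I i t) with hQ | hQ
  · rw [hQ]; simpa using hlog
  have hmo := hmin o
  rw [ucbIndex, if_neg hQ.ne', ucbIndex] at hmo
  split_ifs at hmo with hQo
  -- An unobserved optimal arm would have index `⊥`, below the finite index of the arm played.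
  · exact absurd (le_bot_iff.1 hmo) (EReal.coe_ne_bot _)
  rw [EReal.coe_le_coe_iff] at hmo
  have h1 := abs_le.1 (hgood i hQ)
  have h2 := abs_le.1 (hgood o (Nat.pos_of_ne_zero hQo))
  -- Optimism: `μ_i - 2 S_i ≤ μ̂_i - S_i ≤ μ̂_o - S_o ≤ μ_o`. Squaring turns the 5 of the slack into
  -- 20.
  have hgap : gap D L i ≤ 2 * slack G I i t := by
    unfold gap; rw [← ho]; linarith
  have hQ' : (0 : ℝ) < obsCount G I i t := by exact_mod_cast hQ
  calc (obsCount G I i t : ℝ) * gap D L i ^ 2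
      ≤ obsCount G I i t * (2 * slack G I i t) ^ 2 := by gcongr
    _ = 20 * Real.log t := by
      rw [slack, mul_pow, Real.sq_sqrt (by positivity)]
      field_simp
      ring

open Classical in
/-- Whenever an arm of a clique is played, the whole clique is observed; hence the clique is
played rarely while one of its arms has been observed rarely. -/
lemma card_rarely_observed_le {K : ℕ} {G : Digraph (Fin K)} {I : ℕ → Fin K} {C : Finset (Fin K)}
    (hC : ∀ i ∈ C, ∀ j ∈ C, G.Adj i j) (T : ℕ) {B : ℝ} (hB : 0 ≤ B) :
    (((Finset.range T).filter fun s =>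
      I (s + 1) ∈ C ∧ (obsCount (fun _ => G) I (I (s + 1)) s : ℝ) ≤ B).card : ℝ) ≤ B + 1 := by
  set A := (Finset.range T).filter fun s =>
    I (s + 1) ∈ C ∧ (obsCount (fun _ => G) I (I (s + 1)) s : ℝ) ≤ B with hA
  rcases A.eq_empty_or_nonempty with h0 | hne
  · rw [h0]; simp; linarith
  -- At the last counted play, all earlier counted plays have already observed the arm now played,
  -- so there are at most `B` of them. Index `s` stands for round `s + 1`, which is at most `m` when
  -- `s < m`.
  set m := A.max' hne with hm
  have hmA := Finset.mem_filter.1 (A.max'_mem hne)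
  have hcard : (A.erase m).card ≤ obsCount (fun _ => G) I (I (m + 1)) m := by
    refine Finset.card_le_card_of_injOn (· + 1) (fun s hs => ?_)
      (fun a _ b _ hab => Nat.succ_injective hab)
    have hs' := Finset.mem_erase.1 hs
    have hlt : s < m := lt_of_le_of_ne (A.le_max' s hs'.2) hs'.1
    simp only [Finset.coe_filter, Set.mem_ofPred_eq, Finset.mem_Icc]
    exact ⟨⟨by omega, by omega⟩, hC _ (Finset.mem_filter.1 hs'.2).2.1 _ hmA.2.1⟩
  rw [Finset.card_erase_of_mem (A.max'_mem hne)] at hcard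
  have h1 : A.card ≤ obsCount (fun _ => G) I (I (m + 1)) m + 1 := by omega
  have h2 : (A.card : ℝ) ≤ obsCount (fun _ => G) I (I (m + 1)) m + 1 := by exact_mod_cast h1
  linarith [hmA.2.2]

open Classical in
/-- The loss incurred by rarely observed suboptimal arms of a clique. -/
lemma sum_gap_clique_le {K : ℕ} {G : Digraph (Fin K)} {I : ℕ → Fin K} {C : Finset (Fin K)}
    (hC : ∀ i ∈ C, ∀ j ∈ C, G.Adj i j) (Δ : Fin K → ℝ) (hΔ : ∀ j, Δ j ≤ 1) (T : ℕ) {l : ℝ}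
    (hl : 0 ≤ l) :
    ∑ s ∈ Finset.range T, (if I (s + 1) ∈ C ∧ 0 < Δ (I (s + 1)) ∧
      (obsCount (fun _ => G) I (I (s + 1)) s : ℝ) * Δ (I (s + 1)) ^ 2 ≤ l
      then Δ (I (s + 1)) else 0) ≤ clusterCost Δ C * l + 1 := by
  by_cases hsub : ∃ j ∈ C, 0 < Δ j
  · obtain ⟨M, m, hm, hcost, hMm, j, hj, hMj⟩ := exists_clusterCost_eq Δ C hsub
    have hM1 : M ≤ 1 := hMj ▸ hΔ j
    have hM0 : 0 ≤ M := by
      obtain ⟨i, hi, hi'⟩ := hsub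
      exact hi'.le.trans (hMm i hi hi').2
    -- The smallest gap `m` gives one threshold valid for all suboptimal arms of the clique.
    have hcard := card_rarely_observed_le (I := I) hC T (B := l / m ^ 2) (by positivity)
    calc _ ≤ ∑ s ∈ Finset.range T, (if I (s + 1) ∈ C ∧
          (obsCount (fun _ => G) I (I (s + 1)) s : ℝ) ≤ l / m ^ 2 then M else 0) := by
          refine Finset.sum_le_sum fun s _ => ?_
          split_ifs with h1 h2
          · exact (hMm _ h1.1 h1.2.1).2
          · refine absurd ⟨h1.1, ?_⟩ h2
            rw [le_div_iff₀ (by positivity)]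
            refine le_trans ?_ h1.2.2
            have := (hMm _ h1.1 h1.2.1).1
            gcongr
          · exact hM0
          · exact le_rfl
      _ = M * ((Finset.range T).filter fun s => I (s + 1) ∈ C ∧
          (obsCount (fun _ => G) I (I (s + 1)) s : ℝ) ≤ l / m ^ 2).card := by
          rw [← Finset.sum_filter, Finset.sum_const, nsmul_eq_mul, mul_comm]
      _ ≤ M * (l / m ^ 2 + 1) := by gcongr
      _ = clusterCost Δ C * l + M := by rw [hcost]; ring
      _ ≤ _ := by linarith
  · rw [Finset.sum_eq_zero]
    · have := clusterCost_nonneg Δ C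
      positivity
    · intro s _
      exact if_neg fun h => hsub ⟨_, h.1, h.2.1⟩

open Classical in
/-- Pathwise bound on the pseudo-regret. -/
lemma sum_gap_arm_le {K : ℕ} {Ω Z : Type*} [MeasurableSpace Z] {D : Measure Z}
    [IsProbabilityMeasure D] {L : Fin K → Z → ℝ} (hL : ∀ j, Measurable (L j))
    (hL01 : ∀ j x, L j x ∈ Set.Icc (0 : ℝ) 1) {G : Digraph (Fin K)}
    {z : ℕ → Ω → Z} {I : ℕ → Ω → Fin K} (ω : Ω)
    (hmin : ∀ t j, ucbIndex L (fun _ => G) (fun s => I s ω) (fun s => z s ω) (I (t + 1) ω) t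
      ≤ ucbIndex L (fun _ => G) (fun s => I s ω) (fun s => z s ω) j t)
    {p : ℕ} {C : Fin p → Finset (Fin K)} (hC : IsAdmissiblePartition G C) {T : ℕ} (hT : 1 ≤ T) :
    ∑ s ∈ Finset.range T, gap D L (I (s + 1) ω) ≤
      (20 * (∑ k, clusterCost (gap D L) (C k)) * Real.log T + p + 1) +
        ∑ s ∈ Finset.range T, ∑ j,
          (badEvent D L (fun _ => G) z I j s).indicator (fun _ => (1 : ℝ)) ω := by
  have hgap := gap_mem_Icc (D := D) hL hL01
  let b : ℕ → ℝ := fun s =>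
    ∑ j, (badEvent D L (fun _ => G) z I j s).indicator (fun _ => (1 : ℝ)) ω
  let e : Fin p → ℕ → ℝ := fun k s => if I (s + 1) ω ∈ C k ∧ 0 < gap D L (I (s + 1) ω) ∧
      (obsCount (fun _ => G) (fun s => I s ω) (I (s + 1) ω) s : ℝ) * gap D L (I (s + 1) ω) ^ 2
        ≤ 20 * Real.log T then gap D L (I (s + 1) ω) else 0
  have hind : ∀ j s, 0 ≤ (badEvent D L (fun _ => G) z I j s).indicator (fun _ => (1 : ℝ)) ω :=
    fun j s => Set.indicator_nonneg (fun _ _ => zero_le_one) ω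
  have hb0 : ∀ s, 0 ≤ b s := fun s => Finset.sum_nonneg fun j _ => hind j s
  have he0 : ∀ k s, 0 ≤ e k s := fun k s => by
    simp only [e]; split_ifs
    · exact (hgap _).1
    · exact le_rfl
  -- Four cases: the first round and rounds after a misestimate are charged 1, optimal plays cost
  -- nothing, and any other play is charged to a cell containing the arm.
  have hround : ∀ s ∈ Finset.range T, gap D L (I (s + 1) ω) ≤
      (∑ k, e k s + if s = 0 then 1 else 0) + b s := by
    intro s hs
    have hsT := Finset.mem_range.1 hs
    have hek : 0 ≤ ∑ k, e k s := Finset.sum_nonneg fun k _ => he0 k s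
    by_cases hs0 : s = 0
    · rw [if_pos hs0]; linarith [(hgap (I (s + 1) ω)).2, hb0 s]
    rw [if_neg hs0]
    by_cases hbad : ∃ j, ω ∈ badEvent D L (fun _ => G) z I j s
    · obtain ⟨j, hj⟩ := hbad
      have h1 : 1 ≤ b s := by
        have := Finset.single_le_sum (f := fun j => (badEvent D L (fun _ => G) z I j s).indicator
          (fun _ => (1 : ℝ)) ω) (fun j _ => hind j s) (Finset.mem_univ j)
        simpa [hj] using this
      linarith [(hgap (I (s + 1) ω)).2]
    rcases (hgap (I (s + 1) ω)).1.eq_or_lt with h0 | hpos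
    · rw [← h0]; linarith [hb0 s]
    obtain ⟨k, hk⟩ := hC.covers (I (s + 1) ω)
    have hQ := obsCount_mul_sq_gap_le (D := D) (hmin s) (fun j hj => by
      by_contra hcon
      exact hbad ⟨j, hj, not_le.1 hcon⟩) hpos
    have hlog : Real.log s ≤ Real.log T :=
      Real.log_le_log (by exact_mod_cast Nat.pos_of_ne_zero hs0) (by exact_mod_cast hsT.le)
    have h1 : e k s = gap D L (I (s + 1) ω) := if_pos ⟨hk, hpos, by linarith⟩
    have h2 : e k s ≤ ∑ k, e k s :=
      Finset.single_le_sum (fun k _ => he0 k s) (Finset.mem_univ k)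
    linarith [hb0 s]
  have hclique : ∀ k, ∑ s ∈ Finset.range T, e k s
      ≤ clusterCost (gap D L) (C k) * (20 * Real.log T) + 1 := fun k =>
    sum_gap_clique_le (I := fun s => I s ω) (fun i hi j hj => (hC.reciprocal k i hi j hj).1)
      (gap D L) (fun j => (hgap j).2) T (by have := Real.log_natCast_nonneg T; positivity)
  calc _ ≤ ∑ s ∈ Finset.range T, ((∑ k, e k s + if s = 0 then 1 else 0) + b s) :=
        Finset.sum_le_sum hround
    _ = (∑ k, ∑ s ∈ Finset.range T, e k s + 1) + ∑ s ∈ Finset.range T, b s := by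
        rw [Finset.sum_add_distrib, Finset.sum_add_distrib, Finset.sum_comm,
          Finset.sum_ite_eq', if_pos (Finset.mem_range.2 hT)]
    _ ≤ (∑ k, (clusterCost (gap D L) (C k) * (20 * Real.log T) + 1) + 1)
          + ∑ s ∈ Finset.range T, b s := by
        gcongr with k
        exact hclique k
    _ = _ := by
        rw [Finset.sum_add_distrib, ← Finset.sum_mul]
        simp only [Finset.sum_const, Finset.card_univ, Fintype.card_fin, nsmul_eq_mul, mul_one, b]
        ring

/-- Telescoping: `2 / (n + 2) ^ 2 ≤ 2 / (n + 1) - 2 / (n + 2)`. The term `s = 0` vanishes because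
division by zero gives 0. -/
lemma sum_range_two_div_sq_le (T : ℕ) :
    ∑ s ∈ Finset.range T, (2 : ℝ) / (s : ℝ) ^ 2 ≤ 4 := by
  have h : ∀ n : ℕ, ∑ s ∈ Finset.range (n + 2), (2 : ℝ) / (s : ℝ) ^ 2 ≤ 4 - 2 / ((n : ℝ) + 1) := by
    intro n
    induction n with
    | zero => norm_num [Finset.sum_range_succ]
    | succ n ih =>
      rw [Finset.sum_range_succ]
      have : 2 / ((n + 2 : ℕ) : ℝ) ^ 2 ≤ 2 / ((n : ℝ) + 1) - 2 / ((n + 1 : ℕ) + 1) := by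
        push_cast
        rw [div_sub_div _ _ (by positivity) (by positivity),
          div_le_div_iff₀ (by positivity) (by positivity)]
        nlinarith
      linarith
  calc _ ≤ ∑ s ∈ Finset.range (T + 2), (2 : ℝ) / (s : ℝ) ^ 2 :=
        Finset.sum_le_sum_of_subset_of_nonneg (Finset.range_mono (by omega))
          fun _ _ _ => by positivity
    _ ≤ _ := (h T).trans (by have : (0 : ℝ) ≤ 2 / ((T : ℝ) + 1) := by positivity
                             linarith)

/-! ### From pathwise bounds to expected regret. -/

section Run

variable {K : ℕ} {Ω Z : Type*} {mΩ : MeasurableSpace Ω} [MeasurableSpace Z]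
  {P : Measure Ω} [IsProbabilityMeasure P] {D : Measure Z} [IsProbabilityMeasure D]
  {L : Fin K → Z → ℝ} {ℱ : Filtration ℕ mΩ} {z : ℕ → Ω → Z} {I : ℕ → Ω → Fin K}

/-- The regret is at most the expected sum of the gaps of the arms that are played. -/
lemma IsUCBNTRun.regret_le {G : ℕ → Digraph (Fin K)} [Nonempty (Fin K)]
    (h : IsUCBNTRun P D L G ℱ z I) (hL : ∀ j, Measurable (L j))
    (hL01 : ∀ j x, L j x ∈ Set.Icc (0 : ℝ) 1) (T : ℕ) :
    regret P L z I T ≤ ∫ ω, ∑ s ∈ Finset.range T, gap D L (I (s + 1) ω) ∂P := by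
  have hI : ∀ s, Measurable (I (s + 1)) := fun s => h.measurable_arm (by omega)
  have hz : ∀ s, Measurable (z (s + 1)) := fun s => h.measurable_data (by omega)
  have hbdd : ∀ f : Ω → ℝ, Measurable f → (∀ ω, f ω ∈ Set.Icc (0 : ℝ) 1) → Integrable f P :=
    fun f hf hf01 => Integrable.of_mem_Icc 0 1 hf.aemeasurable (Filter.Eventually.of_forall hf01)
  have hLI : ∀ s, Integrable (fun ω => L (I (s + 1) ω) (z (s + 1) ω)) P := fun s =>
    hbdd _ ((measurable_from_prod_countable_right (f := fun x : Fin K × Z => L x.1 x.2) hL).comp ((hI s).prodMk (hz s))) fun ω => hL01 _ _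
  have hLz : ∀ i s, Integrable (fun ω => L i (z (s + 1) ω)) P := fun i s =>
    hbdd _ ((hL i).comp (hz s)) fun ω => hL01 _ _
  have hg : ∀ s, Integrable (fun ω => gap D L (I (s + 1) ω)) P := fun s =>
    hbdd _ ((measurable_of_finite (gap D L)).comp (hI s)) fun ω => gap_mem_Icc hL hL01 _
  have hshift : ∀ f : ℕ → ℝ, ∑ t ∈ Finset.Icc 1 T, f t = ∑ s ∈ Finset.range T, f (s + 1) :=
    fun f => by
      rw [Finset.range_eq_Ico, Finset.sum_Ico_add' f 0 T 1]
      rfl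
  refine ciSup_le fun i => ?_
  simp_rw [hshift, ← Finset.sum_sub_distrib]
  have hd : ∀ s, Integrable
      (fun ω => L (I (s + 1) ω) (z (s + 1) ω) - L i (z (s + 1) ω)) P := fun s =>
    (hLI s).sub (hLz i s)
  rw [integral_finsetSum _ fun s _ => hd s, integral_finsetSum _ fun s _ => hg s]
  refine Finset.sum_le_sum fun s _ => ?_
  have hm : Integrable (fun ω => meanLoss D L (I (s + 1) ω)) P := by
    refine ((hg s).add (integrable_const (⨅ i, meanLoss D L i))).congr
      (Filter.Eventually.of_forall fun ω => ?_)
    simp [gap]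
  have hLi : ∫ ω, L i (z (s + 1) ω) ∂P = meanLoss D L i := by
    rw [meanLoss, ← h.data_law (s + 1) (by omega),
      integral_map (hz s).aemeasurable (hL i).aestronglyMeasurable]
  have hle : ⨅ i, meanLoss D L i ≤ meanLoss D L i := ciInf_le (Set.finite_range _).bddBelow i
  rw [integral_sub (hLI s) (hLz i s), h.integral_loss_arm hL hL01, hLi]
  simp only [gap]
  rw [integral_sub hm (integrable_const _)]
  simp only [integral_const, probReal_univ, one_smul]
  linarith

/-- Regret of UCB-NT with a constant feedback graph in terms of an admissible partitioning. -/
lemma IsUCBNTRun.regret_le_partition {G : Digraph (Fin K)} [Nonempty (Fin K)]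
    (h : IsUCBNTRun P D L (fun _ => G) ℱ z I) (hL : ∀ j, Measurable (L j))
    (hL01 : ∀ j x, L j x ∈ Set.Icc (0 : ℝ) 1) {T : ℕ} (hT : 1 ≤ T)
    {p : ℕ} {C : Fin p → Finset (Fin K)} (hC : IsAdmissiblePartition G C) :
    regret P L z I T ≤
      20 * (∑ k, clusterCost (gap D L) (C k)) * Real.log T + p + 1 + 4 * K := by
  classical
  refine (h.regret_le hL hL01 T).trans ?_
  have hbad : ∀ j s, Integrable
      ((badEvent D L (fun _ => G) z I j s).indicator fun _ => (1 : ℝ)) P := fun j s =>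
    (integrable_const 1).indicator (h.measurableSet_badEvent hL j s)
  have hsum : ∀ s, Integrable (fun ω => ∑ j,
      (badEvent D L (fun _ => G) z I j s).indicator (fun _ => (1 : ℝ)) ω) P := fun s =>
    integrable_finsetSum _ fun j _ => hbad j s
  have hprob : ∀ j s, P.real (badEvent D L (fun _ => G) z I j s) ≤ 2 / (s : ℝ) ^ 2 := by
    intro j s
    -- At `s = 0` the bound reads `2 / 0 = 0`; it holds because nothing has been observed and the
    -- event is empty.
    rcases Nat.eq_zero_or_pos s with rfl | hs
    · have : badEvent D L (fun _ => G) z I j 0 = ∅ := by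
        ext ω; simp [badEvent, obsCount]
      simp [this]
    · exact h.measureReal_badEvent_le hL hL01 j hs
  refine (integral_mono_of_nonneg
    (Filter.Eventually.of_forall fun ω => Finset.sum_nonneg fun s _ => (gap_mem_Icc hL hL01 _).1)
    ((integrable_const _).add (integrable_finsetSum _ fun s _ => hsum s))
    (Filter.Eventually.of_forall fun ω =>
      sum_gap_arm_le (D := D) hL hL01 ω (fun t j => h.arm_argmin t ω j) hC hT)).trans ?_
  simp only [Pi.add_apply]
  rw [integral_add (integrable_const _) (integrable_finsetSum _ fun s _ => hsum s),
    integral_finsetSum _ fun s _ => hsum s]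
  simp only [integral_const, probReal_univ, one_smul]
  gcongr
  calc _ = ∑ s ∈ Finset.range T, ∑ j, P.real (badEvent D L (fun _ => G) z I j s) := by
        refine Finset.sum_congr rfl fun s _ => ?_
        rw [integral_finsetSum _ fun j _ => hbad j s]
        refine Finset.sum_congr rfl fun j _ => ?_
        exact integral_indicator_one (h.measurableSet_badEvent hL j s)
    _ ≤ ∑ s ∈ Finset.range T, ∑ _j : Fin K, 2 / (s : ℝ) ^ 2 :=
        Finset.sum_le_sum fun s _ => Finset.sum_le_sum fun j _ => hprob j s
    _ = K * ∑ s ∈ Finset.range T, 2 / (s : ℝ) ^ 2 := by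
        simp [Finset.mul_sum]
    _ ≤ K * 4 := by gcongr; exact sum_range_two_div_sq_le T
    _ = 4 * K := mul_comm _ _

end Run

end GraphBandit

/-! ### Assembly of the theorem. -/

theorem mainTheorem6 :
    ∃ c : ℝ, 0 < c ∧
      ∀ (K T : ℕ), 1 ≤ T →
      ∀ (Ω Z : Type*) [MeasurableSpace Ω] [MeasurableSpace Z]
        (P : Measure Ω) [IsProbabilityMeasure P] (D : Measure Z) [IsProbabilityMeasure D]
        (L : Fin K → Z → ℝ), (∀ j, Measurable (L j)) → (∀ j x, L j x ∈ Set.Icc (0 : ℝ) 1) →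
      ∀ (G : Digraph (Fin K)), (∀ i, G.Adj i i) →
      ∀ (ℱ : Filtration ℕ ‹MeasurableSpace Ω›) (z : ℕ → Ω → Z) (I : ℕ → Ω → Fin K),
        GraphBandit.IsUCBNTRun P D L (fun _ => G) ℱ z I →
        ∃ a b : ℝ,
          IsLeast (GraphBandit.partitionValues (GraphBandit.gap D L) (fun _ => G) T) a ∧
          IsLeast (GraphBandit.cliqueCoveringValues (GraphBandit.gap D L) G) b ∧
          GraphBandit.regret P L z I T ≤ c * (a * Real.log T + K) ∧
          a * Real.log T + K ≤ b * Real.log T + K := by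
  -- The logarithmic term dictates 20; the remainder `p + 1 + 4 * K` is at most `6 * K`.
  refine ⟨20, by norm_num, ?_⟩
  intro K T hT Ω Z _ _ P _ D _ L hL hL01 G hG ℱ z I h
  -- That `K ≥ 1` follows from the run itself: a sample point yields an arm.
  obtain ⟨ω⟩ : Nonempty Ω := nonempty_of_isProbabilityMeasure P
  have : Nonempty (Fin K) := ⟨I 0 ω⟩
  have hK : 1 ≤ K := Fin.pos (I 0 ω)
  have hlog : 0 ≤ Real.log T := Real.log_natCast_nonneg T
  obtain ⟨b, hb, hbmin⟩ := Set.exists_min_image _ id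
    (GraphBandit.finite_cliqueCoveringValues (GraphBandit.gap D L) G)
    (GraphBandit.cliqueCoveringValues_nonempty _ G)
  obtain ⟨a', ha', ha'b⟩ := GraphBandit.exists_partitionValue_le hK _ G hG T hb
  obtain ⟨a, ha, hamin⟩ := Set.exists_min_image _ id
    (GraphBandit.finite_partitionValues (GraphBandit.gap D L) (fun _ => G) T) ⟨a', ha'⟩
  refine ⟨a, b, ⟨ha, hamin⟩, ⟨hb, hbmin⟩, ?_, ?_⟩
  · obtain ⟨p, hp, C, hC, hCa⟩ := GraphBandit.exists_isAdmissiblePartition_le hT ha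
    have hreg := h.regret_le_partition hL hL01 hT hC
    have hp' : (p : ℝ) ≤ K := by exact_mod_cast hp
    have hK' : (1 : ℝ) ≤ K := by exact_mod_cast hK
    have := mul_le_mul_of_nonneg_right hCa hlog
    linarith
  · have hab : a ≤ b := (hamin a' ha').trans ha'b
    gcongr
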